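/- Let $\theta:\{1,2,3,\dots\}\to\mathbb{R}\cup\{\infty\}$ be any function with $\theta(1)\ge 2$ and $\theta(n)\ge P^+(n)$ for all $n\ge 2$, where $P^+(n)$ denotes the largest prime factor of $n$. Let $\mathcal{B}=\mathcal{B}_\theta$ be the set of positive integers consisting of $1$ and of all $n\ge 2$ whose prime factorization $n=p_1^{\alpha_1}\cdots p_k^{\alpha_k}$, with primes $p_1<p_2<\dots<p_k$ and exponents $\alpha_i\ge 1$, satisfies $$p_i\le \theta\bigl(p_1^{\alpha_1}\cdots p_{i-1}^{\alpha_{i-1}}\bigr)\qquad(1\le i\le k),$$ where the empty product (the case $i=1$) is $1$. Put $\mathcal{B}(x)=\mathcal{B}\cap[1,x]$, and let $\tau(n)$ be the number of positive divisors of $n$. Then the series $$L=\sum_{n\in\mathcal{B}}\frac{\tau(n)}{n}\prod_{p\le\theta(n)}\left(1-\frac1p\right)^2,$$ in which the product runs over the primes $p\le\theta(n)$ (over all primes, with value $0$, if $\theta(n)=\infty$), converges, its sum satisfies $0\le L\le 1$, and, as $x\to\infty$, $$\sum_{n\in\mathcal{B}(x)}\tau(n)=(1-L)\,x\log x+o(x\log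 x).$$ Consequently, $L=1$ if and only if $\sum_{n\in\mathcal{B}(x)}\tau(n)=o(x\log x)$ as $x\to\infty$. -/

import Mathlib

open scoped Asymptotics

noncomputable section

namespace ThetaSet

/-- `P⁺(n)`, the largest prime factor of `n`, for `n ≥ 2` (the value is `0` for `n = 0, 1`). -/
def largestPrimeFactor (n : ℕ) : ℕ := n.primeFactors.sup id

/-- `τ(n)`, the number of positive divisors of `n`. -/
def tau (n : ℕ) : ℕ := n.divisors.card

/-- The product of the full prime powers `q ^ α` (`α` the exact exponent of `q` in `n`) over the
prime factors `q < p` of `n`. If `n = p₁ ^ α₁ ⋯ pₖ ^ αₖ` with `p₁ < ⋯ < pₖ` and `p = pᵢ`, this is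
`p₁ ^ α₁ ⋯ pᵢ₋₁ ^ αᵢ₋₁` (which is `1` when `i = 1`). -/
def partBelow (n p : ℕ) : ℕ := ∏ q ∈ n.primeFactors with q < p, q ^ n.factorization q

/-- The set `𝓑 = 𝓑_θ` of the positive integers `n = p₁ ^ α₁ ⋯ pₖ ^ αₖ`, `p₁ < ⋯ < pₖ`, with
`pᵢ ≤ θ (p₁ ^ α₁ ⋯ pᵢ₋₁ ^ αᵢ₋₁)` for `1 ≤ i ≤ k`; in particular `1 ∈ 𝓑`. -/
def B (θ : ℕ → WithTop ℝ) : Set ℕ :=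
  {n | 1 ≤ n ∧ ∀ p ∈ n.primeFactors, ((p : ℝ) : WithTop ℝ) ≤ θ (partBelow n p)}

open Classical in
/-- `∑_{n ∈ 𝓑, 1 ≤ n ≤ x} τ(n)`. -/
def T (θ : ℕ → WithTop ℝ) (x : ℝ) : ℝ :=
  ∑ n ∈ Finset.Icc 1 ⌊x⌋₊ with n ∈ B θ, (tau n : ℝ)

/-- `∏_{p ≤ y} (1 - 1/p)²` over the primes `p ≤ y`: a finite product if `y` is a real number,
the (unconditionally convergent, see `multipliable_mertensSq`) infinite product over all primes
if `y = ∞`. -/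
def mertensSq (y : WithTop ℝ) : ℝ :=
  ∏' p : {p : ℕ // p.Prime ∧ ((p : ℝ) : WithTop ℝ) ≤ y}, (1 - 1 / (p : ℝ)) ^ 2

/-- The product defining `mertensSq y` converges unconditionally, possibly to `0`. -/
theorem multipliable_mertensSq (y : WithTop ℝ) :
    Multipliable (fun p : {p : ℕ // p.Prime ∧ ((p : ℝ) : WithTop ℝ) ≤ y} =>
      (1 - 1 / (p : ℝ)) ^ 2) := by
  have h0 : ∀ p : {p : ℕ // p.Prime ∧ ((p : ℝ) : WithTop ℝ) ≤ y},
      0 ≤ (1 - 1 / (p : ℝ)) ^ 2 := fun p => sq_nonneg _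
  have h1 : ∀ p : {p : ℕ // p.Prime ∧ ((p : ℝ) : WithTop ℝ) ≤ y},
      (1 - 1 / (p : ℝ)) ^ 2 ≤ 1 := by
    intro p
    have hp : (1 : ℝ) ≤ (p : ℕ) := by exact_mod_cast p.2.1.one_lt.le
    have h2 : 1 / ((p : ℕ) : ℝ) ≤ 1 := by
      rw [div_le_one (by linarith)]; exact hp
    have h3 : 0 ≤ 1 / ((p : ℕ) : ℝ) := by positivity
    exact pow_le_one₀ (by linarith) (by linarith)
  refine ⟨_, tendsto_atTop_ciInf (f := fun s : Finset _ => ∏ p ∈ s, _) ?_ ⟨0, ?_⟩⟩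
  · intro s t hst
    exact Finset.prod_le_prod_of_subset_of_le_one hst (fun p _ => h0 p) (fun p _ _ => h1 p)
  · rintro _ ⟨s, rfl⟩
    exact Finset.prod_nonneg fun p _ => h0 p

/-- The term `τ(n)/n · ∏_{p ≤ θ(n)} (1 - 1/p)²` of the series `L`. -/
def term (θ : ℕ → WithTop ℝ) (n : ℕ) : ℝ := (tau n : ℝ) / n * mertensSq (θ n)

end ThetaSet

end

/-! Every `m ≥ 1` is uniquely `n * r` with `n ∈ B θ` and all primes of `r` above `θ n`: cut `m` just
before its first prime that violates the defining inequality (`exists_mul_eq`, `eq_of_mul_eq_mul`).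
As `θ n` dominates the primes of `n`, the factors are coprime and `τ(m) = τ(n) τ(r)`. Summing over
`m ≤ x`, the terms with `r = 1` give `T θ x`, and each `n ∈ B θ` contributes a further `τ(n) * tail
(θ n) (x / n)` (`roughTauSum_empty_eq`).

Divide by `x log x`. The full divisor sum tends to `1`, and the share of a fixed `n` tends to `term
θ n`, because sieving `τ` by finitely many primes multiplies its mean by `∏ (1 - 1/p)²`
(`tendsto_roughTauSum`). Shares are nonnegative, so finite sums of terms are at most `1`: the series
converges and `L ≤ 1`. If limit and sum may be interchanged, then `T θ x / (x log x) → 1 - L`.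

Dominated convergence justifies the interchange, from `share ≤ C * term` uniformly in `x` and `n`
(`exists_share_le`). This rests on an upper bound of the right order for `τ` over rough numbers,
uniform in the sieving level (`exists_roughTauSum_le`). It is elementary: products of rough and
smooth numbers are distinct, which bounds the sum of `1/a` over rough `a`; squaring bounds the sum
of `τ(m)/m`; and `τ log = 2 Λ * τ` with Chebyshev's bound removes the weight `1/m`. -/

open Filter Topology Finset

namespace ThetaSet

/-! ### Divisor sums over rough numbers -/

/-- No element of `S` divides `m`. -/
def Rough (S : Finset ℕ) (m : ℕ) : Prop := ∀ p ∈ S, ¬ p ∣ m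

open Classical in
/-- The indicator function of the `S`-rough numbers. -/
noncomputable def roughInd (S : Finset ℕ) (m : ℕ) : ℝ := if Rough S m then 1 else 0

/-- The divisor function restricted to the `S`-rough numbers. -/
noncomputable def roughTau (S : Finset ℕ) (m : ℕ) : ℝ := roughInd S m * tau m

/-- The summatory function of `roughTau`. -/
noncomputable def roughTauSum (S : Finset ℕ) (x : ℝ) : ℝ := ∑ m ∈ Ioc 0 ⌊x⌋₊, roughTau S m

lemma roughInd_nonneg (S : Finset ℕ) (m : ℕ) : 0 ≤ roughInd S m := by
  unfold roughInd; split_ifs <;> simp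

lemma roughInd_of_rough {S : Finset ℕ} {m : ℕ} (h : Rough S m) : roughInd S m = 1 := if_pos h

lemma roughInd_of_not_rough {S : Finset ℕ} {m : ℕ} (h : ¬ Rough S m) : roughInd S m = 0 := if_neg h

lemma roughTau_nonneg (S : Finset ℕ) (m : ℕ) : 0 ≤ roughTau S m :=
  mul_nonneg (roughInd_nonneg S m) (Nat.cast_nonneg _)

lemma roughTau_empty (m : ℕ) : roughTau ∅ m = tau m := by
  rw [roughTau, roughInd_of_rough (by simp [Rough]), one_mul]

lemma rough_mul {S : Finset ℕ} (hS : ∀ p ∈ S, p.Prime) {a b : ℕ} :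
    Rough S (a * b) ↔ Rough S a ∧ Rough S b := by
  constructor
  · exact fun h => ⟨fun p hp hd => h p hp (hd.mul_right b), fun p hp hd => h p hp (hd.mul_left a)⟩
  · rintro ⟨ha, hb⟩ p hp hd
    exact ((hS p hp).dvd_mul.1 hd).elim (ha p hp) (hb p hp)

lemma roughInd_mul {S : Finset ℕ} (hS : ∀ p ∈ S, p.Prime) (a b : ℕ) :
    roughInd S (a * b) = roughInd S a * roughInd S b := by
  by_cases ha : Rough S a
  · by_cases hb : Rough S b
    · rw [roughInd_of_rough ha, roughInd_of_rough hb, roughInd_of_rough ((rough_mul hS).2 ⟨ha, hb⟩),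
        one_mul]
    · rw [roughInd_of_not_rough hb, roughInd_of_not_rough fun h => hb ((rough_mul hS).1 h).2,
        mul_zero]
  · rw [roughInd_of_not_rough ha, roughInd_of_not_rough fun h => ha ((rough_mul hS).1 h).1,
      zero_mul]

lemma rough_prime_pow {S : Finset ℕ} (hS : ∀ p ∈ S, p.Prime) {p : ℕ} (hp : p.Prime)
    (hpS : p ∉ S) (k : ℕ) : Rough S (p ^ k) := by
  intro q hq hd
  have := (Nat.prime_dvd_prime_iff_eq (hS q hq) hp).1 ((hS q hq).dvd_of_dvd_pow hd)
  exact hpS (this ▸ hq)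

lemma tau_mul {a b : ℕ} (h : a.Coprime b) : tau (a * b) = tau a * tau b :=
  h.card_divisors_mul

lemma tau_prime_pow {p : ℕ} (hp : p.Prime) (k : ℕ) : tau (p ^ k) = k + 1 := by
  simp [tau, Nat.divisors_prime_pow hp]

lemma roughTau_prime_pow_mul {S : Finset ℕ} (hS : ∀ p ∈ S, p.Prime) {p : ℕ} (hp : p.Prime)
    (hpS : p ∉ S) (k : ℕ) {h : ℕ} (hh : ¬ p ∣ h) :
    roughTau S (p ^ k * h) = (k + 1) * roughTau S h := by
  rw [roughTau, roughTau, roughInd_mul hS, roughInd_of_rough (rough_prime_pow hS hp hpS k),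
    tau_mul (((Nat.Prime.coprime_iff_not_dvd hp).2 hh).pow_left k), tau_prime_pow hp]
  push_cast
  ring

/-- The local factor of `τ` at `p` is `∑ (k + 1) X ^ k = (1 - X)⁻²`, so convolving with the
coefficients of `(1 - X)² = 1 - 2X + X²` removes the multiples of `p`. -/
lemma roughTau_insert {S : Finset ℕ} (hS : ∀ p ∈ S, p.Prime) {p : ℕ} (hp : p.Prime)
    (hpS : p ∉ S) {m : ℕ} (hm : m ≠ 0) :
    roughTau (insert p S) m = roughTau S m - 2 * (if p ∣ m then roughTau S (m / p) else 0) +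
      (if p ^ 2 ∣ m then roughTau S (m / p ^ 2) else 0) := by
  obtain ⟨k, h, hh, rfl⟩ := Nat.exists_eq_pow_mul_and_not_dvd hm p hp.ne_one
  have hp0 : 0 < p := hp.pos
  rw [roughTau_prime_pow_mul hS hp hpS k hh]
  rcases k with _ | k
  · have h2 : ¬ p ^ 2 ∣ h := fun h' => hh ((dvd_pow_self p two_ne_zero).trans h')
    have : Rough (insert p S) h ↔ Rough S h := by simp [Rough, hh]
    have : roughInd (insert p S) h = roughInd S h := by
      by_cases hr : Rough S h
      · rw [roughInd_of_rough hr, roughInd_of_rough (this.2 hr)]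
      · rw [roughInd_of_not_rough hr, roughInd_of_not_rough (mt this.1 hr)]
    simp [roughTau, hh, h2, this]
  · have h0 : ¬ Rough (insert p S) (p ^ (k + 1) * h) := fun H =>
      H p (mem_insert_self p S) (Dvd.dvd.mul_right (dvd_pow_self p (by simp)) h)
    have h1 : p ^ (k + 1) * h / p = p ^ k * h := by
      rw [pow_succ', mul_assoc, Nat.mul_div_cancel_left _ hp0]
    rw [if_pos (Dvd.dvd.mul_right (dvd_pow_self p (by simp)) h), h1,
      roughTau_prime_pow_mul hS hp hpS k hh, roughTau, roughInd_of_not_rough h0]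
    rcases k with _ | k
    · have h2 : ¬ p ^ 2 ∣ p ^ (0 + 1) * h := by
        rw [zero_add, pow_one, pow_two]
        exact fun h' => hh (Nat.dvd_of_mul_dvd_mul_left hp0 h')
      rw [if_neg h2]; push_cast; ring
    · have h2 : p ^ 2 ∣ p ^ (k + 1 + 1) * h := (pow_dvd_pow p (by omega)).mul_right h
      have h3 : p ^ (k + 1 + 1) * h / p ^ 2 = p ^ k * h := by
        rw [show k + 1 + 1 = 2 + k by omega, pow_add, mul_assoc,
          Nat.mul_div_cancel_left _ (by positivity)]
      rw [if_pos h2, h3, roughTau_prime_pow_mul hS hp hpS k hh]; push_cast; ring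

lemma sum_Ioc_ite_dvd (f : ℕ → ℝ) {d : ℕ} (hd : 0 < d) (N : ℕ) :
    ∑ m ∈ Ioc 0 N, (if d ∣ m then f (m / d) else 0) = ∑ m ∈ Ioc 0 (N / d), f m := by
  rw [← sum_filter]
  refine sum_nbij' (fun m => m / d) (fun m => m * d) ?_ ?_ ?_ ?_ ?_
  · intro m hm
    simp only [mem_filter, mem_Ioc] at hm ⊢
    exact ⟨Nat.div_pos (Nat.le_of_dvd hm.1.1 hm.2) hd, Nat.div_le_div_right hm.1.2⟩
  · intro m hm
    simp only [mem_filter, mem_Ioc] at hm ⊢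
    exact ⟨⟨Nat.mul_pos hm.1 hd, (Nat.le_div_iff_mul_le hd).1 hm.2⟩, dvd_mul_left d m⟩
  · intro m hm
    exact Nat.div_mul_cancel (mem_filter.1 hm).2
  · intro m _
    exact Nat.mul_div_cancel m hd
  · intros; rfl

lemma roughTauSum_insert {S : Finset ℕ} (hS : ∀ p ∈ S, p.Prime) {p : ℕ} (hp : p.Prime)
    (hpS : p ∉ S) (x : ℝ) :
    roughTauSum (insert p S) x =
      roughTauSum S x - 2 * roughTauSum S (x / p) + roughTauSum S (x / (p ^ 2 : ℕ)) := by
  unfold roughTauSum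
  rw [Nat.floor_div_natCast, Nat.floor_div_natCast, ← sum_Ioc_ite_dvd _ hp.pos,
    ← sum_Ioc_ite_dvd _ (pow_pos hp.pos 2), mul_sum, ← sum_sub_distrib, ← sum_add_distrib]
  exact sum_congr rfl fun m hm => roughTau_insert hS hp hpS (mem_Ioc.1 hm).1.ne'

lemma sum_Ioc_tau (N : ℕ) : ∑ m ∈ Ioc 0 N, tau m = ∑ m ∈ Ioc 0 N, N / m := by
  rw [← ArithmeticFunction.sum_Ioc_sigma0_eq_sum_div]
  simp [tau, ArithmeticFunction.sigma_zero_apply]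

lemma sum_Ioc_inv (N : ℕ) : ∑ m ∈ Ioc 0 N, (m : ℝ)⁻¹ = (harmonic N : ℝ) := by
  rw [harmonic_eq_sum_Icc]
  push_cast
  rfl

/-- The sum is `∑ ⌊x / m⌋`. Dropping the floors costs at most `1` per term, and the harmonic sum
lies between `log x` and `1 + log x`. -/
lemma abs_roughTauSum_empty_sub_le {x : ℝ} (hx : 1 ≤ x) :
    |roughTauSum ∅ x - x * Real.log x| ≤ x := by
  have hN := Nat.floor_le (zero_le_one.trans hx)
  have hN1 : 1 ≤ ⌊x⌋₊ := Nat.le_floor (by simpa using hx)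
  set N := ⌊x⌋₊ with hNdef
  have e : roughTauSum ∅ x = ∑ m ∈ Ioc 0 N, ((⌊x / m⌋₊ : ℕ) : ℝ) := by
    simp only [roughTauSum, roughTau_empty, Nat.floor_div_natCast]
    exact_mod_cast sum_Ioc_tau _
  have eh : ∑ m ∈ Ioc 0 N, x / m = x * (harmonic N : ℝ) := by
    rw [← sum_Ioc_inv, mul_sum]; rfl
  have up : roughTauSum ∅ x ≤ x * (harmonic N : ℝ) := by
    rw [e, ← eh]
    exact sum_le_sum fun m _ => Nat.floor_le (by positivity)
  have lo : x * (harmonic N : ℝ) - N ≤ roughTauSum ∅ x := by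
    have : ∑ m ∈ Ioc 0 N, (x / m - 1) ≤ roughTauSum ∅ x := by
      rw [e]
      exact sum_le_sum fun m _ => (Nat.sub_one_lt_floor _).le
    rw [sum_sub_distrib, eh] at this
    simpa using this
  have h1 := harmonic_floor_le_one_add_log x hx
  have h2 := log_le_harmonic_floor x (by linarith)
  rw [abs_le]
  constructor <;> nlinarith

lemma tendsto_roughTauSum_empty :
    Tendsto (fun x => roughTauSum ∅ x / (x * Real.log x)) atTop (𝓝 1) := by
  have h0 : Tendsto (fun x : ℝ => (Real.log x)⁻¹) atTop (𝓝 0) :=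
    Real.tendsto_log_atTop.inv_tendsto_atTop
  rw [tendsto_iff_dist_tendsto_zero]
  refine squeeze_zero' (Eventually.of_forall fun _ => dist_nonneg) ?_ h0
  filter_upwards [eventually_gt_atTop 1] with x hx
  have hl : 0 < Real.log x := Real.log_pos hx
  have hx0 : 0 < x := by linarith
  have e : roughTauSum ∅ x / (x * Real.log x) - 1 =
      (roughTauSum ∅ x - x * Real.log x) / (x * Real.log x) := by field_simp
  rw [Real.dist_eq, e, abs_div, abs_of_pos (mul_pos hx0 hl), div_le_iff₀ (mul_pos hx0 hl)]
  refine (abs_roughTauSum_empty_sub_le hx.le).trans_eq ?_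
  field_simp

lemma tendsto_log_div_div_log {d : ℝ} (hd : 0 < d) :
    Tendsto (fun x : ℝ => Real.log (x / d) / Real.log x) atTop (𝓝 1) := by
  have h0 : Tendsto (fun x : ℝ => 1 - Real.log d * (Real.log x)⁻¹) atTop (𝓝 (1 - Real.log d * 0)) :=
    (Real.tendsto_log_atTop.inv_tendsto_atTop.const_mul _).const_sub _
  rw [mul_zero, sub_zero] at h0
  refine h0.congr' ?_
  filter_upwards [eventually_gt_atTop 1] with x hx
  have hl : 0 < Real.log x := Real.log_pos hx
  rw [Real.log_div (by linarith) hd.ne']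
  field_simp

lemma tendsto_comp_div_mul_log {F : ℝ → ℝ} {c d : ℝ} (hd : 0 < d)
    (h : Tendsto (fun x => F x / (x * Real.log x)) atTop (𝓝 c)) :
    Tendsto (fun x => F (x / d) / (x * Real.log x)) atTop (𝓝 (c / d)) := by
  have h1 := ((h.comp (tendsto_id.atTop_div_const hd)).mul (tendsto_log_div_div_log hd)).div_const d
  rw [mul_one] at h1
  refine h1.congr' ?_
  filter_upwards [eventually_gt_atTop 1, eventually_gt_atTop d] with x hx hxd
  have hl : 0 < Real.log x := Real.log_pos hx
  have hl' : 0 < Real.log (x / d) := Real.log_pos (by rwa [one_lt_div hd])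
  have hx0 : 0 < x := by linarith
  simp only [Function.comp_apply, id]
  field_simp

/-- The mean value of `τ` over the integers free of prime factors from `S`. -/
lemma tendsto_roughTauSum (S : Finset ℕ) (hS : ∀ p ∈ S, p.Prime) :
    Tendsto (fun x => roughTauSum S x / (x * Real.log x)) atTop
      (𝓝 (∏ p ∈ S, (1 - 1 / (p : ℝ)) ^ 2)) := by
  induction S using Finset.induction_on with
  | empty => simpa using tendsto_roughTauSum_empty
  | insert p S hpS ih =>
    have hp : p.Prime := hS p (mem_insert_self p S)
    have hS' : ∀ q ∈ S, q.Prime := fun q hq => hS q (mem_insert_of_mem hq)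
    have hp0 : (0 : ℝ) < p := by exact_mod_cast hp.pos
    have hp2 : (0 : ℝ) < (p ^ 2 : ℕ) := by exact_mod_cast pow_pos hp.pos 2
    have h := ih hS'
    have h1 := (h.sub ((tendsto_comp_div_mul_log hp0 h).const_mul 2)).add
      (tendsto_comp_div_mul_log hp2 h)
    rw [prod_insert hpS]
    convert! h1 using 1
    · ext x
      rw [roughTauSum_insert hS' hp hpS]
      ring
    · congr 1
      push_cast
      field_simp
      ring

/-! ### Sums over smooth numbers -/

lemma hasSum_smoothNumbers_inv (N : ℕ) :
    HasSum (fun m : N.smoothNumbers => ((m : ℕ) : ℝ)⁻¹)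
      (∏ p ∈ N.primesBelow, (1 - (p : ℝ)⁻¹)⁻¹) := by
  have h := (EulerProduct.summable_and_hasSum_smoothNumbers_prod_primesBelow_geometric
    (f := { toFun := fun m : ℕ => (m : ℝ)⁻¹, map_one' := by simp,
            map_mul' := fun a b => by push_cast; rw [mul_inv] })
    (fun {p} hp => ?_) N).2
  · exact h
  · have : (1 : ℝ) < p := by exact_mod_cast hp.one_lt
    simpa using inv_lt_one_of_one_lt₀ this

/-- This is minus the derivative at `s = 1` of the Euler product over `p < N`. The induction writes
`m = p ^ k * m'`, splits `log m = k log p + log m'`, and uses the series `∑ p⁻ᵏ` and `∑ k p⁻ᵏ`. -/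
lemma hasSum_smoothNumbers_log_mul_inv (N : ℕ) :
    HasSum (fun m : N.smoothNumbers => Real.log (m : ℕ) * ((m : ℕ) : ℝ)⁻¹)
      ((∏ p ∈ N.primesBelow, (1 - (p : ℝ)⁻¹)⁻¹) *
        ∑ p ∈ N.primesBelow, Real.log p / ((p : ℝ) - 1)) := by
  induction N with
  | zero =>
    have h : ∀ m : Nat.smoothNumbers 0, Real.log (m : ℕ) * ((m : ℕ) : ℝ)⁻¹ = 0 := by
      rintro ⟨m, hm⟩
      rw [Nat.smoothNumbers_zero, Set.mem_singleton_iff] at hm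
      simp [hm]
    simp only [h]
    simp
  | succ p ih =>
    by_cases hp : p.Prime
    · have hpp : p ∉ p.primesBelow := fun h => lt_irrefl _ (Nat.lt_of_mem_primesBelow h)
      rw [Nat.primesBelow_succ, if_pos hp, prod_insert hpp, sum_insert hpp,
        ← (Nat.equivProdNatSmoothNumbers hp).hasSum_iff]
      have hp1 : (1 : ℝ) < p := by exact_mod_cast hp.one_lt
      have hp0 : (0 : ℝ) < p := by linarith
      have hr : ‖((p : ℝ)⁻¹)‖ < 1 := by
        rw [Real.norm_of_nonneg (by positivity)]; exact inv_lt_one_of_one_lt₀ hp1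
      have hZ := hasSum_smoothNumbers_inv p
      have hg := hasSum_geometric_of_norm_lt_one hr
      have hk := hasSum_coe_mul_geometric_of_norm_lt_one hr
      have s1 := hk.summable.mul_of_nonneg hZ.summable (fun _ => by positivity)
        (fun _ => by positivity)
      have s2 := hg.summable.mul_of_nonneg ih.summable (fun _ => by positivity)
        (fun m => mul_nonneg (Real.log_natCast_nonneg _) (by positivity))
      have h := ((hk.mul hZ s1).mul_left (Real.log p)).add (hg.mul ih s2)
      convert! h using 1
      · ext ⟨k, m⟩
        have hm : ((m : ℕ) : ℝ) ≠ 0 :=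
          Nat.cast_ne_zero.2 (Nat.ne_zero_of_mem_smoothNumbers m.2)
        simp only [Function.comp_apply, Nat.equivProdNatSmoothNumbers_apply']
        push_cast
        rw [Real.log_mul (by positivity) hm, Real.log_pow]
        field_simp
        simp only [one_div, inv_pow]
        field_simp
      · have : (p : ℝ) - 1 ≠ 0 := by linarith
        field_simp
    · rw [Nat.primesBelow_succ, if_neg hp]
      rw [Nat.smoothNumbers_succ hp]
      exact ih

/-- One half of the Euler product over `p < N` is carried by the `N`-smooth numbers up to `X`. -/
lemma prod_primesBelow_inv_le_sum {N X : ℕ}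
    (hX : 2 * ∑ p ∈ N.primesBelow, Real.log p / ((p : ℝ) - 1) < Real.log X) :
    (∏ p ∈ N.primesBelow, (1 - (p : ℝ)⁻¹)⁻¹) ≤
      2 * ∑ b ∈ X.smoothNumbersUpTo N, (b : ℝ)⁻¹ := by
  classical
  set Z := ∏ p ∈ N.primesBelow, (1 - (p : ℝ)⁻¹)⁻¹
  set A := ∑ p ∈ N.primesBelow, Real.log p / ((p : ℝ) - 1)
  have hZ := hasSum_smoothNumbers_inv N
  have hZA := hasSum_smoothNumbers_log_mul_inv N
  have hZ0 : 0 ≤ Z := hZ.nonneg fun _ => by positivity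
  have hA0 : 0 ≤ A := sum_nonneg fun p hp => div_nonneg (Real.log_natCast_nonneg _) (by
    have : 1 < p := (Nat.prime_of_mem_primesBelow hp).one_lt
    have : (1 : ℝ) < p := by exact_mod_cast this
    linarith)
  have hlX : 0 < Real.log X := by linarith
  have hX0 : (0 : ℝ) < X := by
    rcases Nat.eq_zero_or_pos X with h | h
    · simp [h] at hlX
    · exact_mod_cast h
  have hfin : HasSum (fun m : N.smoothNumbers => if (m : ℕ) ≤ X then ((m : ℕ) : ℝ)⁻¹ else 0)
      (∑ b ∈ X.smoothNumbersUpTo N, (b : ℝ)⁻¹) := by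
    have h1 : ∑ b ∈ X.smoothNumbersUpTo N, (b : ℝ)⁻¹ =
        ∑ b ∈ X.smoothNumbersUpTo N,
          N.smoothNumbers.indicator (fun m => if m ≤ X then (m : ℝ)⁻¹ else 0) b := by
      refine sum_congr rfl fun b hb => ?_
      rw [Nat.mem_smoothNumbersUpTo] at hb
      rw [Set.indicator_of_mem hb.2, if_pos hb.1]
    rw [h1]
    refine (hasSum_subtype_iff_indicator (f := fun m : ℕ => if m ≤ X then (m : ℝ)⁻¹ else 0)).2
      (hasSum_sum_of_ne_finset_zero fun b hb => ?_)
    rw [Nat.mem_smoothNumbersUpTo, not_and] at hb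
    by_cases h : b ≤ X
    · exact Set.indicator_of_notMem (hb h) _
    · simp [Set.indicator, h]
  -- Markov's inequality: `1 ≤ [m ≤ X] + log m / log X`, weighted by `1 / m`. The mean `A` of `log
  -- m` is below `log X / 2`, so the second part is at most `Z / 2`.
  have key := hasSum_le (fun m : N.smoothNumbers => ?_) hZ
    (hfin.add (hZA.div_const (Real.log X)))
  · have h2 : Z * A / Real.log X ≤ Z / 2 := by
      rw [div_le_div_iff₀ hlX two_pos]
      nlinarith
    change Z ≤ _ + Z * A / _ at key
    linarith
  · by_cases h : (m : ℕ) ≤ X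
    · rw [if_pos h]
      exact le_add_of_nonneg_right
        (div_nonneg (mul_nonneg (Real.log_natCast_nonneg _) (by positivity)) hlX.le)
    · rw [if_neg h, zero_add, le_div_iff₀ hlX, mul_comm]
      have : Real.log X ≤ Real.log (m : ℕ) :=
        Real.log_le_log hX0 (by exact_mod_cast (not_le.1 h).le)
      gcongr

/-! ### Chebyshev and Mertens type bounds -/

-- `∑ Λ(d) ⌊N / d⌋ = log N! ≤ N log N`; dropping the floors costs at most `ψ(N)`, which is `O(N)` by
-- Chebyshev.
open ArithmeticFunction in
lemma sum_vonMangoldt_div_le {N : ℕ} (hN : 1 ≤ N) :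
    ∑ d ∈ Ioc 0 N, vonMangoldt d / d ≤ Real.log N + (Real.log 4 + 4) := by
  have hN0 : (0 : ℝ) < N := by exact_mod_cast hN
  have h1 := sum_Ioc_mul_zeta_eq_sum vonMangoldt N
  rw [vonMangoldt_mul_zeta] at h1
  have h2 : ∑ n ∈ Ioc 0 N, log n ≤ N * Real.log N := by
    have : ∑ n ∈ Ioc 0 N, log n ≤ ∑ n ∈ Ioc 0 N, Real.log N :=
      sum_le_sum fun n hn => Real.log_le_log (by exact_mod_cast (mem_Ioc.1 hn).1)
        (by exact_mod_cast (mem_Ioc.1 hn).2)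
    simpa using this
  have h3 : N * ∑ d ∈ Ioc 0 N, vonMangoldt d / d - ∑ d ∈ Ioc 0 N, vonMangoldt d ≤
      ∑ d ∈ Ioc 0 N, vonMangoldt d * ((N / d : ℕ) : ℝ) := by
    rw [mul_sum, ← sum_sub_distrib]
    refine sum_le_sum fun d _ => ?_
    have h : (N : ℝ) / d - 1 ≤ ((N / d : ℕ) : ℝ) := by
      rw [← Nat.floor_div_eq_div (K := ℝ)]
      exact (Nat.sub_one_lt_floor _).le
    calc N * (vonMangoldt d / d) - vonMangoldt d = vonMangoldt d * ((N : ℝ) / d - 1) := by ring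
      _ ≤ _ := mul_le_mul_of_nonneg_left h vonMangoldt_nonneg
  have h4 : ∑ d ∈ Ioc 0 N, vonMangoldt d ≤ (Real.log 4 + 4) * N := by
    have := Chebyshev.psi_le_const_mul_self (x := N) hN0.le
    simpa [Chebyshev.psi] using this
  have h5 : N * ∑ d ∈ Ioc 0 N, vonMangoldt d / d ≤ N * (Real.log N + (Real.log 4 + 4)) := by
    linarith
  exact le_of_mul_le_mul_left h5 hN0

lemma sum_primesBelow_log_div_le {N : ℕ} (hN : 1 ≤ N) :
    ∑ p ∈ N.primesBelow, Real.log p / ((p : ℝ) - 1) ≤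
      2 * (Real.log N + (Real.log 4 + 4)) := by
  refine le_trans ?_ (mul_le_mul_of_nonneg_left (sum_vonMangoldt_div_le hN) two_pos.le)
  rw [mul_sum]
  calc ∑ p ∈ N.primesBelow, Real.log p / ((p : ℝ) - 1)
      ≤ ∑ p ∈ N.primesBelow, 2 * (ArithmeticFunction.vonMangoldt p / p) := by
        refine sum_le_sum fun p hp => ?_
        have hp := Nat.prime_of_mem_primesBelow hp
        have h2 : (2 : ℝ) ≤ p := by exact_mod_cast hp.two_le
        rw [ArithmeticFunction.vonMangoldt_apply_prime hp, ← mul_div_assoc,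
          div_le_div_iff₀ (by linarith) (by linarith)]
        nlinarith [Real.log_natCast_nonneg p]
    _ ≤ _ := by
        refine sum_le_sum_of_subset_of_nonneg (fun p hp => ?_) fun d _ _ =>
          mul_nonneg two_pos.le (div_nonneg ArithmeticFunction.vonMangoldt_nonneg (by positivity))
        exact mem_Ioc.2 ⟨(Nat.prime_of_mem_primesBelow hp).pos, (Nat.lt_of_mem_primesBelow hp).le⟩

/-- Mertens' product is at most `1 / log N`. -/
lemma log_le_prod_primesBelow_inv (N : ℕ) :
    Real.log N ≤ ∏ p ∈ N.primesBelow, (1 - (p : ℝ)⁻¹)⁻¹ := by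
  rcases Nat.eq_zero_or_pos N with rfl | hN
  · simp
  obtain ⟨M, rfl⟩ := Nat.exists_eq_add_of_le' hN
  refine (log_add_one_le_harmonic M).trans ?_
  rw [← sum_Ioc_inv]
  have h := sum_le_hasSum (f := fun m : (M + 1).smoothNumbers => ((m : ℕ) : ℝ)⁻¹)
    ((Ioc 0 M).attach.map ⟨fun m => ⟨m.1, Nat.mem_smoothNumbers_of_lt (mem_Ioc.1 m.2).1
      (Nat.lt_succ_of_le (mem_Ioc.1 m.2).2)⟩, fun a b h => Subtype.ext (Subtype.mk.inj h)⟩)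
    (fun _ _ => by positivity) (hasSum_smoothNumbers_inv (M + 1))
  rw [sum_map] at h
  exact (sum_attach (Ioc 0 M) fun m => (m : ℝ)⁻¹).symm.trans_le h

/-! ### Upper bounds for rough numbers -/

lemma rough_of_dvd {S : Finset ℕ} {a b : ℕ} (h : Rough S b) (hab : a ∣ b) : Rough S a :=
  fun p hp hd => h p hp (hd.trans hab)

lemma coprime_of_rough_of_smooth {N a b : ℕ} (ha : Rough N.primesBelow a)
    (hb : b ∈ N.smoothNumbers) : a.Coprime b := by
  refine Nat.Coprime.symm (Nat.coprime_of_dvd fun p hp hpb hpa => ?_)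
  have hpN := Nat.mem_smoothNumbers'.1 hb p hp hpb
  exact ha p (Nat.mem_primesBelow.2 ⟨hpN, hp⟩) hpa

/-- An integer splits in at most one way as rough times smooth, so the products `a * b` are distinct
integers up to `M * X`. -/
lemma sum_roughInd_div_mul_sum_smooth_le (N M X : ℕ) :
    (∑ a ∈ Ioc 0 M, roughInd N.primesBelow a / a) *
      ∑ b ∈ X.smoothNumbersUpTo N, (b : ℝ)⁻¹ ≤ (harmonic (M * X) : ℝ) := by
  classical
  have h1 : ∑ a ∈ Ioc 0 M, roughInd N.primesBelow a / a =
      ∑ a ∈ Ioc 0 M with Rough N.primesBelow a, (a : ℝ)⁻¹ := by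
    rw [sum_filter]
    refine sum_congr rfl fun a _ => ?_
    split_ifs with h
    · rw [roughInd_of_rough h, one_div]
    · rw [roughInd_of_not_rough h, zero_div]
  rw [h1, sum_mul_sum, ← sum_product', ← sum_Ioc_inv]
  have hinj : Set.InjOn (fun x : ℕ × ℕ => x.1 * x.2)
      (({a ∈ Ioc 0 M | Rough N.primesBelow a} ×ˢ X.smoothNumbersUpTo N : Finset (ℕ × ℕ)) :
        Set (ℕ × ℕ)) := by
    rintro ⟨a, b⟩ h ⟨a', b'⟩ h' e
    simp only [coe_product, Set.mem_prod, mem_coe, mem_filter, mem_Ioc,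
      Nat.mem_smoothNumbersUpTo] at h h' e
    have d1 : a ∣ a' := (coprime_of_rough_of_smooth h.1.2 h'.2.2).dvd_of_dvd_mul_right
      (e ▸ dvd_mul_right a b)
    have d2 : a' ∣ a := (coprime_of_rough_of_smooth h'.1.2 h.2.2).dvd_of_dvd_mul_right
      (e ▸ dvd_mul_right a' b')
    have ea := Nat.dvd_antisymm d1 d2
    subst ea
    rw [Nat.mul_left_cancel h.1.1.1 e]
  calc _ = ∑ x ∈ {a ∈ Ioc 0 M | Rough N.primesBelow a} ×ˢ X.smoothNumbersUpTo N,
        ((x.1 * x.2 : ℕ) : ℝ)⁻¹ := sum_congr rfl fun x _ => by push_cast; rw [mul_inv]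
    _ = ∑ m ∈ ({a ∈ Ioc 0 M | Rough N.primesBelow a} ×ˢ X.smoothNumbersUpTo N).image
        (fun x : ℕ × ℕ => (x.1 * x.2 : ℕ)), ((m : ℕ) : ℝ)⁻¹ := (sum_image hinj (f := fun m : ℕ => (m : ℝ)⁻¹)).symm
    _ ≤ _ := by
        refine sum_le_sum_of_subset_of_nonneg (fun m hm => ?_) fun _ _ _ => by positivity
        obtain ⟨⟨a, b⟩, h, rfl⟩ := mem_image.1 hm
        simp only [mem_product, mem_filter, mem_Ioc, Nat.mem_smoothNumbersUpTo] at h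
        exact mem_Ioc.2 ⟨Nat.mul_pos h.1.1.1 (Nat.pos_of_ne_zero
          (Nat.ne_zero_of_mem_smoothNumbers h.2.2)), Nat.mul_le_mul h.1.1.2 h.2.1⟩

/-- Take smooth numbers up to `X = N ^ K`: they carry half of the Euler product, while `log (M * X)`
is still `O(log M)`. -/
lemma exists_sum_roughInd_div_le : ∃ C : ℝ, 0 ≤ C ∧ ∀ N M : ℕ, 3 ≤ N → N ≤ M + 1 →
    ∑ a ∈ Ioc 0 M, roughInd N.primesBelow a / a ≤
      C * Real.log M * ∏ p ∈ N.primesBelow, (1 - (p : ℝ)⁻¹) := by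
  set c : ℝ := Real.log 4 + 4
  have hc : 0 ≤ c := add_nonneg (Real.log_nonneg (by norm_num)) (by norm_num)
  -- Carrying half of the product needs `4 (log N + c) < K log N`; since `N ≥ 3` gives `log N ≥ 1`,
  -- `K ≥ 5 + 4c` suffices.
  set K : ℕ := 5 + ⌈4 * c⌉₊
  have hK : 5 + 4 * c ≤ (K : ℝ) := by
    push_cast [K]
    linarith [Nat.le_ceil (4 * c)]
  -- From `1 ≤ 2 log M` and `log N ≤ 2 log M`, `1 + log M + K log N ≤ (3 + 2K) log M`; the outer `2`
  -- pays for the half product.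
  refine ⟨2 * (3 + 2 * K), by positivity, fun N M hN hNM => ?_⟩
  have hM2 : 2 ≤ M := by omega
  have hlN : 1 ≤ Real.log N := by
    rw [Real.le_log_iff_exp_le (by positivity)]
    have : (3 : ℝ) ≤ N := by exact_mod_cast hN
    linarith [Real.exp_one_lt_d9]
  have hlM : 1 / 2 ≤ Real.log M := by
    have : Real.log 2 ≤ Real.log M := Real.log_le_log two_pos (by exact_mod_cast hM2)
    linarith [Real.log_two_gt_d9]
  have hlNM : Real.log N ≤ 2 * Real.log M := by
    have : Real.log N ≤ Real.log ((M : ℝ) ^ 2) := by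
      refine Real.log_le_log (by positivity) ?_
      have : N ≤ M ^ 2 := by nlinarith
      exact_mod_cast this
    simpa using this
  have hX := prod_primesBelow_inv_le_sum (N := N) (X := N ^ K) (by
    have h := sum_primesBelow_log_div_le (N := N) (by omega)
    push_cast
    rw [Real.log_pow]
    have : (5 + 4 * c) * Real.log N ≤ K * Real.log N := by gcongr
    nlinarith)
  have hH := sum_roughInd_div_mul_sum_smooth_le N M (N ^ K)
  set H := ∑ a ∈ Ioc 0 M, roughInd N.primesBelow a / a
  have hH0 : 0 ≤ H := sum_nonneg fun a _ => div_nonneg (roughInd_nonneg _ a) (by positivity)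
  set V := ∏ p ∈ N.primesBelow, (1 - (p : ℝ)⁻¹) with hV
  have hV0 : 0 < V := prod_pos fun p hp => by
    have : (1 : ℝ) < p := by exact_mod_cast (Nat.prime_of_mem_primesBelow hp).one_lt
    linarith [inv_lt_one_of_one_lt₀ this]
  rw [prod_inv_distrib, ← hV] at hX
  have h1 : (harmonic (M * N ^ K) : ℝ) ≤ (3 + 2 * K) * Real.log M := by
    refine (harmonic_le_one_add_log _).trans ?_
    push_cast
    rw [Real.log_mul (by positivity) (by positivity), Real.log_pow]
    have : K * Real.log N ≤ K * (2 * Real.log M) := by gcongr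
    linarith
  have h2 : H * V⁻¹ ≤ 2 * ((3 + 2 * K) * Real.log M) := by
    have := mul_le_mul_of_nonneg_left hX hH0
    linarith
  rw [← div_eq_mul_inv, div_le_iff₀ hV0] at h2
  linarith

lemma sum_Ioc_sum_divisorsAntidiagonal (f g : ℕ → ℝ) (N : ℕ) :
    ∑ n ∈ Ioc 0 N, ∑ x ∈ n.divisorsAntidiagonal, f x.1 * g x.2 =
      ∑ n ∈ Ioc 0 N, f n * ∑ m ∈ Ioc 0 (N / n), g m := by
  -- Arithmetic functions must vanish at `0`; resetting that value affects neither side.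
  let F (h : ℕ → ℝ) : ArithmeticFunction ℝ := ⟨fun n => if n = 0 then 0 else h n, if_pos rfl⟩
  have hF (h : ℕ → ℝ) {n : ℕ} (hn : n ≠ 0) : F h n = h n := if_neg hn
  have := ArithmeticFunction.sum_Ioc_mul_eq_sum_sum (F f) (F g) N
  convert this using 1
  · refine sum_congr rfl fun n hn => ?_
    rw [ArithmeticFunction.mul_apply]
    refine sum_congr rfl fun x hx => ?_
    rw [hF f (Nat.ne_zero_of_mem_divisorsAntidiagonal hx).1,
      hF g (Nat.ne_zero_of_mem_divisorsAntidiagonal hx).2]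
  · refine sum_congr rfl fun n hn => ?_
    rw [hF f (mem_Ioc.1 hn).1.ne']
    congr 1
    exact sum_congr rfl fun m hm => (hF g (mem_Ioc.1 hm).1.ne').symm

-- Both sides equal `∑ (log d + log e)` over `d * e = m`: by symmetry this is `2 (log * 1)(m)`, and
-- `log = Λ * 1`, `τ = 1 * 1`.
open ArithmeticFunction in
lemma tau_mul_log (m : ℕ) :
    tau m * Real.log m = 2 * ∑ x ∈ m.divisorsAntidiagonal, vonMangoldt x.1 * tau x.2 := by
  have h1 : ∑ x ∈ m.divisorsAntidiagonal, vonMangoldt x.1 * tau x.2 =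
      ∑ x ∈ m.divisorsAntidiagonal, Real.log x.1 := by
    have h : (vonMangoldt * ((zeta : ArithmeticFunction ℝ) * (zeta : ArithmeticFunction ℝ))) m =
        (log * (zeta : ArithmeticFunction ℝ)) m := by
      rw [← mul_assoc, vonMangoldt_mul_zeta]
    rw [ArithmeticFunction.mul_apply, ArithmeticFunction.mul_apply] at h
    convert h using 1
    · refine sum_congr rfl fun x hx => ?_
      rw [coe_zeta_mul_apply]
      congr 1
      rw [tau, card_eq_sum_ones]
      push_cast
      refine sum_congr rfl fun d hd => ?_
      rw [natCoe_apply, zeta_apply, if_neg (Nat.pos_of_mem_divisors hd).ne', Nat.cast_one]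
    · refine sum_congr rfl fun x hx => ?_
      rw [natCoe_apply, zeta_apply, if_neg (Nat.ne_zero_of_mem_divisorsAntidiagonal hx).2,
        Nat.cast_one, mul_one, log_apply]
  have h2 : ∑ x ∈ m.divisorsAntidiagonal, Real.log x.2 =
      ∑ x ∈ m.divisorsAntidiagonal, Real.log x.1 := by
    conv_lhs => rw [← Nat.map_swap_divisorsAntidiagonal, sum_map]
    rfl
  have h3 : ∑ x ∈ m.divisorsAntidiagonal, (Real.log x.1 + Real.log x.2) =
      tau m * Real.log m := by
    have h : ∀ x ∈ m.divisorsAntidiagonal, Real.log x.1 + Real.log x.2 = Real.log m := by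
      intro x hx
      have h0 := Nat.ne_zero_of_mem_divisorsAntidiagonal hx
      rw [← Real.log_mul (by exact_mod_cast h0.1) (by exact_mod_cast h0.2), ← Nat.cast_mul,
        (Nat.mem_divisorsAntidiagonal.1 hx).1]
    rw [sum_congr rfl h, sum_const, nsmul_eq_mul, tau, ← Nat.map_div_right_divisors, card_map]
  rw [← h3, sum_add_distrib, h1, h2]
  ring

/-- In `τ log = 2 Λ * τ` the cofactor of a rough number is rough. Forgetting roughness of the `Λ`
variable leaves `ψ(M / m)`, bounded by Chebyshev. -/
lemma sum_roughTau_mul_log_le (S : Finset ℕ) (M : ℕ) :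
    ∑ m ∈ Ioc 0 M, roughTau S m * Real.log m ≤
      2 * (Real.log 4 + 4) * M * ∑ m ∈ Ioc 0 M, roughTau S m / m := by
  have h1 : ∀ m ∈ Ioc 0 M, roughTau S m * Real.log m ≤
      2 * ∑ x ∈ m.divisorsAntidiagonal, roughTau S x.1 * ArithmeticFunction.vonMangoldt x.2 := by
    intro m _
    by_cases hm : Rough S m
    · rw [roughTau, roughInd_of_rough hm, one_mul, tau_mul_log]
      conv_rhs => rw [← Nat.map_swap_divisorsAntidiagonal, sum_map]
      refine le_of_eq (congrArg _ (sum_congr rfl fun x hx => ?_))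
      have : Rough S x.2 := rough_of_dvd hm (Dvd.intro_left _ (Nat.mem_divisorsAntidiagonal.1 hx).1)
      simp [roughTau, roughInd_of_rough this, mul_comm]
    · rw [roughTau, roughInd_of_not_rough hm, zero_mul, zero_mul]
      exact mul_nonneg two_pos.le (sum_nonneg fun x _ => mul_nonneg (roughTau_nonneg _ _)
        ArithmeticFunction.vonMangoldt_nonneg)
  refine (sum_le_sum h1).trans ?_
  rw [← mul_sum, sum_Ioc_sum_divisorsAntidiagonal, mul_assoc, mul_assoc, mul_sum (f := fun m =>
    roughTau S m / m), mul_sum (f := fun m => M * (roughTau S m / m))]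
  refine mul_le_mul_of_nonneg_left (sum_le_sum fun m _ => ?_) two_pos.le
  have h2 : ∑ d ∈ Ioc 0 (M / m), ArithmeticFunction.vonMangoldt d ≤
      (Real.log 4 + 4) * (M / m : ℝ) := by
    have := Chebyshev.psi_le_const_mul_self (x := (M / m : ℝ)) (by positivity)
    rwa [Chebyshev.psi, Nat.floor_div_eq_div] at this
  calc _ ≤ roughTau S m * ((Real.log 4 + 4) * (M / m : ℝ)) :=
        mul_le_mul_of_nonneg_left h2 (roughTau_nonneg _ _)
    _ = _ := by ring

/-- The rough indicator is completely multiplicative, so `roughTau S m / m` is the convolution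
square of `roughInd S a / a`; the constraint `a * b ≤ M` is then relaxed to `a, b ≤ M`. -/
lemma sum_roughTau_div_le {S : Finset ℕ} (hS : ∀ p ∈ S, p.Prime) (M : ℕ) :
    ∑ m ∈ Ioc 0 M, roughTau S m / m ≤ (∑ a ∈ Ioc 0 M, roughInd S a / a) ^ 2 := by
  have h1 : ∀ m ∈ Ioc 0 M, roughTau S m / m =
      ∑ x ∈ m.divisorsAntidiagonal, (roughInd S x.1 / x.1) * (roughInd S x.2 / x.2) := by
    intro m _
    have h : ∀ x ∈ m.divisorsAntidiagonal,
        (roughInd S x.1 / x.1) * (roughInd S x.2 / x.2) = roughInd S m / m := by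
      intro x hx
      rw [← (Nat.mem_divisorsAntidiagonal.1 hx).1, roughInd_mul hS]
      push_cast
      ring
    rw [sum_congr rfl h, sum_const, nsmul_eq_mul, roughTau, tau, ← Nat.map_div_right_divisors,
      card_map]
    ring
  have h0 : ∀ a : ℕ, 0 ≤ roughInd S a / a := fun a =>
    div_nonneg (roughInd_nonneg S a) (by positivity)
  rw [sum_congr rfl h1,
    sum_Ioc_sum_divisorsAntidiagonal (fun a => roughInd S a / a) (fun a => roughInd S a / a),
    sq, sum_mul]
  refine sum_le_sum fun a _ => mul_le_mul_of_nonneg_left ?_ (h0 a)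
  exact sum_le_sum_of_subset_of_nonneg (Ioc_subset_Ioc_right (Nat.div_le_self M a))
    fun b _ _ => h0 b

/-- Writing `log M = log m + log (M / m)` with `log (M / m) ≤ M / m` reduces the unweighted sum to
the two sums already bounded. -/
lemma log_mul_sum_roughTau_le {S : Finset ℕ} (hS : ∀ p ∈ S, p.Prime) (M : ℕ) :
    Real.log M * ∑ m ∈ Ioc 0 M, roughTau S m ≤
      (2 * (Real.log 4 + 4) + 1) * M * (∑ a ∈ Ioc 0 M, roughInd S a / a) ^ 2 := by
  have h1 : Real.log M * ∑ m ∈ Ioc 0 M, roughTau S m ≤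
      ∑ m ∈ Ioc 0 M, roughTau S m * Real.log m + M * ∑ m ∈ Ioc 0 M, roughTau S m / m := by
    rw [mul_sum, mul_sum, ← sum_add_distrib]
    refine sum_le_sum fun m hm => ?_
    have hm0 : (0 : ℝ) < m := by exact_mod_cast (mem_Ioc.1 hm).1
    have hM0 : (0 : ℝ) < M := hm0.trans_le (by exact_mod_cast (mem_Ioc.1 hm).2)
    have h : Real.log M ≤ Real.log m + M / m := by
      have := Real.log_le_sub_one_of_pos (div_pos hM0 hm0)
      rw [Real.log_div hM0.ne' hm0.ne'] at this
      linarith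
    calc Real.log M * roughTau S m ≤ (Real.log m + M / m) * roughTau S m :=
          mul_le_mul_of_nonneg_right h (roughTau_nonneg _ _)
      _ = _ := by ring
  have h2 := sum_roughTau_mul_log_le S M
  have hc : 0 ≤ (2 * (Real.log 4 + 4) + 1) * (M : ℝ) := by
    have : 0 ≤ Real.log 4 := Real.log_nonneg (by norm_num)
    positivity
  have h3 := mul_le_mul_of_nonneg_left (sum_roughTau_div_le hS M) hc
  linarith

/-- An upper bound of the right order of magnitude for the sum of `τ` over rough numbers. -/
lemma exists_roughTauSum_le : ∃ C : ℝ, 0 ≤ C ∧ ∀ (N : ℕ) (x : ℝ), 3 ≤ N → (N : ℝ) ≤ x + 1 →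
    roughTauSum N.primesBelow x ≤
      C * (x * Real.log x) * ∏ p ∈ N.primesBelow, (1 - 1 / (p : ℝ)) ^ 2 := by
  obtain ⟨C, hC, h⟩ := exists_sum_roughInd_div_le
  set D : ℝ := 2 * (Real.log 4 + 4) + 1
  have hD : 0 ≤ D := by
    have : 0 ≤ Real.log 4 := Real.log_nonneg (by norm_num)
    positivity
  refine ⟨D * C ^ 2, by positivity, fun N x hN hNx => ?_⟩
  have hN' : (3 : ℝ) ≤ N := by exact_mod_cast hN
  have hx2 : 2 ≤ x := by linarith
  have hfl := Nat.floor_le (zero_le_two.trans hx2)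
  have hNM : N ≤ ⌊x⌋₊ + 1 := by
    have : N - 1 ≤ ⌊x⌋₊ := Nat.le_floor (by
      rw [Nat.cast_sub (by omega)]; push_cast; linarith)
    omega
  set M := ⌊x⌋₊ with hMdef
  have hM2 : 2 ≤ M := by omega
  have hM2' : (2 : ℝ) ≤ M := by exact_mod_cast hM2
  have hl : 0 < Real.log M := Real.log_pos (by linarith)
  have h1 := log_mul_sum_roughTau_le (S := N.primesBelow)
    (fun p hp => Nat.prime_of_mem_primesBelow hp) M
  have h2 := h N M hN hNM
  set V := ∏ p ∈ N.primesBelow, (1 - (p : ℝ)⁻¹) with hV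
  have hV2 : ∏ p ∈ N.primesBelow, (1 - 1 / (p : ℝ)) ^ 2 = V ^ 2 := by
    rw [hV, ← prod_pow]; simp only [one_div]
  have hH0 : 0 ≤ ∑ a ∈ Ioc 0 M, roughInd N.primesBelow a / a :=
    sum_nonneg fun a _ => div_nonneg (roughInd_nonneg _ a) (by positivity)
  have h3 : Real.log M * roughTauSum N.primesBelow x ≤
      Real.log M * (D * C ^ 2 * (M * Real.log M) * V ^ 2) := by
    calc _ ≤ D * M * (∑ a ∈ Ioc 0 M, roughInd N.primesBelow a / a) ^ 2 := h1
      _ ≤ D * M * (C * Real.log M * V) ^ 2 := by gcongr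
      _ = _ := by ring
  refine (le_of_mul_le_mul_left h3 hl).trans ?_
  rw [hV2]
  gcongr

/-! ### The unique factorization `m = n * r` with `n ∈ B θ` and all primes of `r` above `θ n` -/

/-- All prime factors of `r` exceed `y`. -/
def PrimesAbove (y : WithTop ℝ) (r : ℕ) : Prop := ∀ p ∈ r.primeFactors, y < ((p : ℝ) : WithTop ℝ)

/-- `θ n` is at least every prime factor of `n`. -/
def DominatesPrimes (θ : ℕ → WithTop ℝ) : Prop :=
  ∀ n : ℕ, ∀ p ∈ n.primeFactors, ((p : ℝ) : WithTop ℝ) ≤ θ n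

lemma dominatesPrimes_of_largestPrimeFactor_le {θ : ℕ → WithTop ℝ}
    (hθ : ∀ n : ℕ, 2 ≤ n → ((largestPrimeFactor n : ℝ) : WithTop ℝ) ≤ θ n) :
    DominatesPrimes θ := by
  intro n p hp
  have hn : 2 ≤ n := (Nat.prime_of_mem_primeFactors hp).two_le.trans
    (Nat.le_of_mem_primeFactors hp)
  refine le_trans ?_ (hθ n hn)
  have : p ≤ largestPrimeFactor n := le_sup (f := id) hp
  exact_mod_cast this

lemma coe_le_coe_withTop {a b : ℕ} (h : a ≤ b) :
    ((a : ℝ) : WithTop ℝ) ≤ ((b : ℝ) : WithTop ℝ) := by exact_mod_cast h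

lemma partBelow_ne_zero (n p : ℕ) : partBelow n p ≠ 0 :=
  prod_ne_zero_iff.2 fun _ hq =>
    pow_ne_zero _ (Nat.prime_of_mem_primeFactors (mem_filter.1 hq).1).ne_zero

lemma factorization_partBelow (n p q : ℕ) :
    (partBelow n p).factorization q = if q < p then n.factorization q else 0 := by
  have h : partBelow n p = (n.factorization.filter (· < p)).prod (· ^ ·) := by
    rw [partBelow, Finsupp.prod, Finsupp.support_filter, Nat.support_factorization]
    exact prod_congr rfl fun q hq => by
      rw [Finsupp.filter_apply_pos (· < p) _ (mem_filter.1 hq).2]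
  rw [h, Nat.prod_pow_factorization_eq_self, Finsupp.filter_apply]
  intro q hq
  rw [Finsupp.support_filter, Nat.support_factorization] at hq
  exact Nat.prime_of_mem_primeFactors (mem_filter.1 hq).1

lemma factorization_mul_of_primesAbove {θ : ℕ → WithTop ℝ} (hθ : DominatesPrimes θ) {n r : ℕ}
    (hn : n ≠ 0) (hr0 : r ≠ 0) (hr : PrimesAbove (θ n) r) {q : ℕ} (hq : q ∈ n.primeFactors) :
    (n * r).factorization q = n.factorization q := by
  have : r.factorization q = 0 := by
    rw [← Finsupp.notMem_support_iff, Nat.support_factorization]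
    exact fun h => absurd (hθ n q hq) (not_le.2 (hr q h))
  rw [Nat.factorization_mul hn hr0, Finsupp.add_apply, this, add_zero]

lemma coprime_of_primesAbove {θ : ℕ → WithTop ℝ} (hθ : DominatesPrimes θ) {n r : ℕ}
    (hn : n ≠ 0) (hr0 : r ≠ 0) (hr : PrimesAbove (θ n) r) : n.Coprime r := by
  refine Nat.coprime_of_dvd fun p hp hpn hpr => ?_
  exact absurd (hθ n p (Nat.mem_primeFactors.2 ⟨hp, hpn, hn⟩))
    (not_le.2 (hr p (Nat.mem_primeFactors.2 ⟨hp, hpr, hr0⟩)))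

/-- Let `p` be the least prime of `n'` missing from `n`. Then `p ∣ r`, so `p > θ n`; but the part of
`n'` below `p` is exactly `n`, and `n' ∈ B θ` forces `p ≤ θ n`. -/
lemma primeFactors_subset_of_mul_eq_mul {θ : ℕ → WithTop ℝ} (hθ : DominatesPrimes θ)
    {n r n' r' : ℕ} (hn : n ≠ 0) (hn' : n' ∈ B θ) (hr0 : r ≠ 0) (hr0' : r' ≠ 0)
    (hr : PrimesAbove (θ n) r) (hr' : PrimesAbove (θ n') r') (h : n * r = n' * r') :
    n'.primeFactors ⊆ n.primeFactors := by
  have hn0' : n' ≠ 0 := Nat.one_le_iff_ne_zero.1 hn'.1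
  intro p
  induction p using Nat.strong_induction_on with
  | _ p ih =>
    intro hp
    by_contra hpn
    have hpp := Nat.prime_of_mem_primeFactors hp
    have hpr : p ∈ r.primeFactors := by
      have : p ∈ (n * r).primeFactors := by
        rw [h, Nat.primeFactors_mul hn0' hr0']
        exact mem_union_left _ hp
      rw [Nat.primeFactors_mul hn hr0] at this
      exact (mem_union.1 this).resolve_left hpn
    -- Primes of `n` lie below `p`, since `p > θ n`; primes of `r'` lie above `p`, since `p ≤ θ n'`.
    -- Below `p` the exponents in `n` and `n'` therefore agree.
    have key : partBelow n' p = n := by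
      refine Nat.eq_of_factorization_eq (partBelow_ne_zero _ _) hn fun q => ?_
      rw [factorization_partBelow]
      split_ifs with hqp
      · by_cases hq' : q ∈ n'.primeFactors
        · rw [← factorization_mul_of_primesAbove hθ hn hr0 hr (ih q hqp hq'), h,
            factorization_mul_of_primesAbove hθ hn0' hr0' hr' hq']
        · have hq : q ∉ n.primeFactors := by
            intro hq
            have : q ∈ (n' * r').primeFactors := by
              rw [← h, Nat.primeFactors_mul hn hr0]
              exact mem_union_left _ hq
            rw [Nat.primeFactors_mul hn0' hr0'] at this
            have h1 := hr' q ((mem_union.1 this).resolve_left hq')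
            exact absurd (h1.trans_le (coe_le_coe_withTop hqp.le)) (not_lt.2 (hθ n' p hp))
          rw [← Nat.support_factorization, Finsupp.notMem_support_iff] at hq hq'
          rw [hq, hq']
      · have hq : q ∉ n.primeFactors := fun hq => absurd
          ((hr p hpr).trans_le (coe_le_coe_withTop (not_lt.1 hqp))) (not_lt.2 (hθ n q hq))
        rw [← Nat.support_factorization, Finsupp.notMem_support_iff] at hq
        rw [hq]
    have h1 := hn'.2 p hp
    rw [key] at h1
    exact absurd h1 (not_le.2 (hr p hpr))

lemma eq_of_mul_eq_mul {θ : ℕ → WithTop ℝ} (hθ : DominatesPrimes θ)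
    {n r n' r' : ℕ} (hn : n ∈ B θ) (hn' : n' ∈ B θ) (hr0 : r ≠ 0) (hr0' : r' ≠ 0)
    (hr : PrimesAbove (θ n) r) (hr' : PrimesAbove (θ n') r') (h : n * r = n' * r') : n = n' := by
  have hn0 : n ≠ 0 := Nat.one_le_iff_ne_zero.1 hn.1
  have hn0' : n' ≠ 0 := Nat.one_le_iff_ne_zero.1 hn'.1
  have hs := (primeFactors_subset_of_mul_eq_mul hθ hn0' hn hr0' hr0 hr' hr h.symm).antisymm
    (primeFactors_subset_of_mul_eq_mul hθ hn0 hn' hr0 hr0' hr hr' h)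
  refine Nat.eq_of_factorization_eq hn0 hn0' fun q => ?_
  by_cases hq : q ∈ n.primeFactors
  · rw [← factorization_mul_of_primesAbove hθ hn0 hr0 hr hq, h,
      factorization_mul_of_primesAbove hθ hn0' hr0' hr' (hs ▸ hq)]
  · have hq' := hs ▸ hq
    rw [← Nat.support_factorization, Finsupp.notMem_support_iff] at hq hq'
    rw [hq, hq']

/-- Take `n = partBelow m p` for the least prime `p ∣ m` with `p > θ (partBelow m p)`. Minimality
puts `n` in `B θ`, and the primes of the cofactor are at least `p > θ n`. -/
lemma exists_mul_eq (θ : ℕ → WithTop ℝ) {m : ℕ} (hm : m ≠ 0) :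
    ∃ n ∈ B θ, ∃ r, r ≠ 0 ∧ PrimesAbove (θ n) r ∧ n * r = m := by
  classical
  by_cases hmB : m ∈ B θ
  · exact ⟨m, hmB, 1, one_ne_zero, by simp [PrimesAbove], mul_one m⟩
  have hex : ∃ p, p ∈ m.primeFactors ∧ θ (partBelow m p) < ((p : ℝ) : WithTop ℝ) := by
    by_contra! H
    exact hmB ⟨Nat.one_le_iff_ne_zero.2 hm, H⟩
  obtain ⟨hp, hpθ⟩ := Nat.find_spec hex
  set p := Nat.find hex
  have hmin : ∀ q < p, q ∈ m.primeFactors → ((q : ℝ) : WithTop ℝ) ≤ θ (partBelow m q) :=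
    fun q hq hqm => not_lt.1 fun H => Nat.find_min hex hq ⟨hqm, H⟩
  have hn0 := partBelow_ne_zero m p
  have hdvd : partBelow m p ∣ m := by
    rw [← Nat.factorization_le_iff_dvd hn0 hm]
    intro q
    rw [factorization_partBelow]
    split_ifs <;> simp
  have hlt : ∀ q ∈ (partBelow m p).primeFactors, q < p := by
    intro q hq
    by_contra hqp
    rw [← Nat.support_factorization, Finsupp.mem_support_iff, factorization_partBelow,
      if_neg hqp] at hq
    exact hq rfl
  refine ⟨partBelow m p, ⟨Nat.one_le_iff_ne_zero.2 hn0, fun q hq => ?_⟩, m / partBelow m p,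
    (Nat.div_pos (Nat.le_of_dvd (Nat.pos_of_ne_zero hm) hdvd) (Nat.pos_of_ne_zero hn0)).ne',
    fun q hq => ?_, Nat.mul_div_cancel' hdvd⟩
  · have e : partBelow (partBelow m p) q = partBelow m q := by
      refine Nat.eq_of_factorization_eq (partBelow_ne_zero _ _) (partBelow_ne_zero _ _) fun t => ?_
      simp only [factorization_partBelow]
      have := hlt q hq
      split_ifs <;> first | rfl | omega
    rw [e]
    exact hmin q (hlt q hq) (Nat.primeFactors_mono hdvd hm hq)
  · refine hpθ.trans_le (coe_le_coe_withTop ?_)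
    by_contra hqp
    rw [← Nat.support_factorization, Finsupp.mem_support_iff, Nat.factorization_div hdvd,
      Finsupp.tsub_apply, factorization_partBelow, if_pos (not_le.1 hqp), Nat.sub_self] at hq
    exact hq rfl

open Classical in
/-- The sum of `τ(r)` over `1 < r ≤ x` with all prime factors of `r` above `y`. -/
noncomputable def tail (y : WithTop ℝ) (x : ℝ) : ℝ :=
  ∑ r ∈ Ioc 1 ⌊x⌋₊ with PrimesAbove y r, (tau r : ℝ)

open Classical in
lemma sum_tau_eq_sum_sum {θ : ℕ → WithTop ℝ} (hθ : DominatesPrimes θ) (N : ℕ) :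
    ∑ m ∈ Ioc 0 N, (tau m : ℝ) = ∑ n ∈ Ioc 0 N with n ∈ B θ,
      ∑ r ∈ Ioc 0 (N / n) with PrimesAbove (θ n) r, (tau n : ℝ) * tau r := by
  rw [sum_sigma']
  symm
  refine sum_nbij (fun x => x.1 * x.2) ?_ ?_ ?_ ?_
  · rintro ⟨n, r⟩ h
    simp only [mem_sigma, mem_filter, mem_Ioc] at h ⊢
    exact ⟨Nat.mul_pos h.1.1.1 h.2.1.1,
      mul_comm n r ▸ (Nat.le_div_iff_mul_le h.1.1.1).1 h.2.1.2⟩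
  · rintro ⟨n, r⟩ h ⟨n', r'⟩ h' e
    simp only [coe_sigma, Set.mem_sigma_iff, mem_coe, mem_filter, mem_Ioc] at h h' e
    have := eq_of_mul_eq_mul hθ h.1.2 h'.1.2 h.2.1.1.ne' h'.2.1.1.ne' h.2.2 h'.2.2 e
    subst this
    rw [Nat.mul_left_cancel h.1.1.1 e]
  · intro m hm
    simp only [mem_coe, mem_Ioc] at hm
    obtain ⟨n, hn, r, hr0, hr, rfl⟩ := exists_mul_eq θ hm.1.ne'
    have hn0 : 0 < n := hn.1
    refine ⟨⟨n, r⟩, ?_, rfl⟩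
    simp only [coe_sigma, Set.mem_sigma_iff, mem_coe, mem_filter, mem_Ioc]
    exact ⟨⟨⟨hn0, (Nat.le_mul_of_pos_right n (Nat.pos_of_ne_zero hr0)).trans hm.2⟩, hn⟩,
      ⟨Nat.pos_of_ne_zero hr0, (Nat.le_div_iff_mul_le hn0).2 (mul_comm n r ▸ hm.2)⟩, hr⟩
  · rintro ⟨n, r⟩ h
    simp only [mem_sigma, mem_filter, mem_Ioc] at h
    rw [tau_mul (coprime_of_primesAbove hθ h.1.1.1.ne' h.2.1.1.ne' h.2.2), Nat.cast_mul]

open Classical in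
/-- Summing `τ` over all integers up to `x`, sorted by their component in `B θ`. -/
lemma roughTauSum_empty_eq {θ : ℕ → WithTop ℝ} (hθ : DominatesPrimes θ) (x : ℝ) :
    roughTauSum ∅ x = T θ x + ∑ n ∈ Ioc 0 ⌊x⌋₊ with n ∈ B θ, tau n * tail (θ n) (x / n) := by
  simp only [roughTauSum, roughTau_empty]
  rw [sum_tau_eq_sum_sum hθ, T, show Icc 1 ⌊x⌋₊ = Ioc 0 ⌊x⌋₊ from rfl, ← sum_add_distrib]
  refine sum_congr rfl fun n hn => ?_
  rw [mem_filter, mem_Ioc] at hn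
  have h1 : 1 ≤ ⌊x⌋₊ / n := Nat.div_pos hn.1.2 hn.1.1
  have h2 : Ioc 0 (⌊x⌋₊ / n) = insert 1 (Ioc 1 (⌊x⌋₊ / n)) := by
    ext r; simp only [mem_Ioc, mem_insert]; omega
  rw [h2, filter_insert, if_pos (by simp [PrimesAbove]), sum_insert (by simp), tail,
    Nat.floor_div_natCast, mul_sum]
  simp [tau]

/-! ### Asymptotics and bounds for `tail` -/

lemma tail_nonneg (y : WithTop ℝ) (x : ℝ) : 0 ≤ tail y x := sum_nonneg fun _ _ => Nat.cast_nonneg _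

/-- This disposes of sieving levels beyond `x`, where the rough number bound does not apply. -/
lemma tail_eq_zero_of_le {y : WithTop ℝ} {x : ℝ} (hx : 0 ≤ x) (h : (x : WithTop ℝ) ≤ y) :
    tail y x = 0 := by
  classical
  refine sum_eq_zero fun r hr => ?_
  rw [mem_filter, mem_Ioc] at hr
  have hr1 : r ≠ 1 := hr.1.1.ne'
  have hr0 : r ≠ 0 := by omega
  have h1 := hr.2 r.minFac (Nat.mem_primeFactors.2 ⟨Nat.minFac_prime hr1, r.minFac_dvd, hr0⟩)
  have h2 : (r.minFac : ℝ) ≤ x := by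
    have : r.minFac ≤ ⌊x⌋₊ := (Nat.minFac_le (Nat.pos_of_ne_zero hr0)).trans hr.1.2
    exact (Nat.cast_le.2 this).trans (Nat.floor_le hx)
  exact absurd (h.trans_lt h1) (not_lt.2 (by exact_mod_cast h2))

lemma tail_top (x : ℝ) : tail ⊤ x = 0 := by
  classical
  refine sum_eq_zero fun r hr => ?_
  rw [mem_filter, mem_Ioc] at hr
  have hr0 : r ≠ 0 := by omega
  exact absurd (hr.2 r.minFac
    (Nat.mem_primeFactors.2 ⟨Nat.minFac_prime hr.1.1.ne', r.minFac_dvd, hr0⟩)) not_top_lt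

lemma mem_primesBelow_floor_iff {z : ℝ} (hz : 0 ≤ z) (p : ℕ) :
    p ∈ (⌊z⌋₊ + 1).primesBelow ↔ p.Prime ∧ ((p : ℝ) : WithTop ℝ) ≤ z := by
  rw [Nat.mem_primesBelow, Nat.lt_succ_iff, Nat.le_floor_iff hz, WithTop.coe_le_coe, and_comm]

lemma primesAbove_coe_iff {z : ℝ} (hz : 0 ≤ z) {r : ℕ} (hr : r ≠ 0) :
    PrimesAbove z r ↔ Rough (⌊z⌋₊ + 1).primesBelow r := by
  constructor
  · intro h p hp hd
    rw [mem_primesBelow_floor_iff hz] at hp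
    exact absurd hp.2 (not_le.2 (h p (Nat.mem_primeFactors.2 ⟨hp.1, hd, hr⟩)))
  · intro h p hp
    by_contra H
    exact h p ((mem_primesBelow_floor_iff hz p).2
      ⟨Nat.prime_of_mem_primeFactors hp, not_lt.1 H⟩) (Nat.dvd_of_mem_primeFactors hp)

lemma tail_coe_eq {z x : ℝ} (hz : 0 ≤ z) (hx : 1 ≤ x) :
    tail z x = roughTauSum (⌊z⌋₊ + 1).primesBelow x - 1 := by
  classical
  have h1 : 1 ≤ ⌊x⌋₊ := Nat.le_floor (by simpa using hx)
  have h2 : Ioc 0 ⌊x⌋₊ = insert 1 (Ioc 1 ⌊x⌋₊) := by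
    ext r; simp only [mem_Ioc, mem_insert]; omega
  have h3 : Rough (⌊z⌋₊ + 1).primesBelow 1 := fun p hp hd =>
    (Nat.prime_of_mem_primesBelow hp).one_lt.ne' (Nat.dvd_one.1 hd)
  rw [roughTauSum, h2, sum_insert (by simp), roughTau, roughInd_of_rough h3, tail, sum_filter]
  simp only [tau, Nat.divisors_one, card_singleton, Nat.cast_one, mul_one, add_sub_cancel_left]
  refine sum_congr rfl fun r hr => ?_
  have hr0 : r ≠ 0 := by rw [mem_Ioc] at hr; omega
  by_cases h : PrimesAbove z r
  · rw [if_pos h, roughTau, roughInd_of_rough ((primesAbove_coe_iff hz hr0).1 h), one_mul, tau]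
  · rw [if_neg h, roughTau, roughInd_of_not_rough fun H => h ((primesAbove_coe_iff hz hr0).2 H),
      zero_mul]

lemma mertensSq_coe {z : ℝ} (hz : 0 ≤ z) :
    mertensSq z = ∏ p ∈ (⌊z⌋₊ + 1).primesBelow, (1 - 1 / (p : ℝ)) ^ 2 := by
  rw [← Finset.tprod_subtype, mertensSq]
  exact ((Equiv.subtypeEquivRight (mem_primesBelow_floor_iff hz)).tprod_eq
    fun p : {p : ℕ // p.Prime ∧ ((p : ℝ) : WithTop ℝ) ≤ z} => (1 - 1 / ((p : ℕ) : ℝ)) ^ 2).symm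

lemma mertensSq_nonneg (y : WithTop ℝ) : 0 ≤ mertensSq y :=
  ge_of_tendsto (multipliable_mertensSq y).hasProd
    (Eventually.of_forall fun _ => prod_nonneg fun _ _ => sq_nonneg _)

lemma mertensSq_antitone : Antitone mertensSq := by
  classical
  intro y y' h
  let e : {p : ℕ // p.Prime ∧ ((p : ℝ) : WithTop ℝ) ≤ y} ↪
      {p : ℕ // p.Prime ∧ ((p : ℝ) : WithTop ℝ) ≤ y'} :=
    ⟨fun p => ⟨p.1, p.2.1, p.2.2.trans h⟩, fun a b hab => Subtype.ext (Subtype.mk.inj hab)⟩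
  refine ge_of_tendsto (multipliable_mertensSq y).hasProd (Eventually.of_forall fun s => ?_)
  refine le_of_tendsto (multipliable_mertensSq y').hasProd ?_
  filter_upwards [eventually_ge_atTop (s.map e)] with t ht
  have h1 : ∏ p ∈ s, (1 - 1 / ((p : ℕ) : ℝ)) ^ 2 =
      ∏ p ∈ s.map e, (1 - 1 / ((p : ℕ) : ℝ)) ^ 2 := by rw [prod_map]; rfl
  rw [h1]
  refine prod_le_prod_of_subset_of_le_one ht (fun p _ => sq_nonneg _) fun p _ _ => ?_
  have hp : (1 : ℝ) ≤ (p : ℕ) := by exact_mod_cast p.2.1.one_lt.le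
  have h2 : 1 / ((p : ℕ) : ℝ) ≤ 1 := (div_le_one (by linarith)).2 hp
  have h3 : 0 ≤ 1 / ((p : ℕ) : ℝ) := by positivity
  exact pow_le_one₀ (by linarith) (by linarith)

/-- By monotonicity the value is at most the product over `p ≤ N`, hence at most `1 / log² (N + 1)`,
for every `N ≥ 1`. -/
lemma mertensSq_top : mertensSq ⊤ = 0 := by
  refine le_antisymm ?_ (mertensSq_nonneg _)
  have h0 : Tendsto (fun N : ℕ => ((Real.log (N + 1 : ℕ))⁻¹) ^ 2) atTop (𝓝 (0 ^ 2)) :=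
    ((Real.tendsto_log_atTop.comp (tendsto_natCast_atTop_atTop.comp
      (tendsto_add_atTop_nat 1))).inv_tendsto_atTop).pow 2
  rw [zero_pow two_ne_zero] at h0
  refine ge_of_tendsto h0 ?_
  filter_upwards [eventually_ge_atTop 1] with N hN
  refine (mertensSq_antitone (le_top (a := ((N : ℝ) : WithTop ℝ)))).trans ?_
  rw [mertensSq_coe (Nat.cast_nonneg N), Nat.floor_natCast, prod_pow]
  have hl : 0 < Real.log (N + 1 : ℕ) := Real.log_pos (by exact_mod_cast Nat.lt_succ_of_le hN)
  have h1 := inv_anti₀ hl (log_le_prod_primesBelow_inv (N + 1))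
  rw [prod_inv_distrib, inv_inv] at h1
  simp only [one_div]
  refine pow_le_pow_left₀ (prod_nonneg fun p hp => ?_) h1 2
  have hp : (1 : ℝ) ≤ p := by exact_mod_cast (Nat.prime_of_mem_primesBelow hp).one_lt.le
  linarith [inv_le_one_of_one_le₀ hp]

lemma tendsto_tail {y : WithTop ℝ} (hy : 0 ≤ y) :
    Tendsto (fun x => tail y x / (x * Real.log x)) atTop (𝓝 (mertensSq y)) := by
  induction y using WithTop.recTopCoe with
  | top => simp [tail_top, mertensSq_top]
  | coe z =>
    have hz : 0 ≤ z := by exact_mod_cast hy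
    rw [mertensSq_coe hz]
    have h1 := tendsto_roughTauSum (⌊z⌋₊ + 1).primesBelow
      fun p hp => Nat.prime_of_mem_primesBelow hp
    have h2 : Tendsto (fun x : ℝ => (x * Real.log x)⁻¹) atTop (𝓝 0) :=
      (tendsto_id.atTop_mul_atTop₀ Real.tendsto_log_atTop).inv_tendsto_atTop
    have h3 := h1.sub h2
    rw [sub_zero] at h3
    refine h3.congr' ?_
    filter_upwards [eventually_ge_atTop 1] with x hx
    rw [tail_coe_eq hz hx, sub_div, one_div]

/-- For `x ≤ y` the tail vanishes. Otherwise `N = ⌊y⌋ + 1` is admissible for the rough number bound: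
`y ≥ 2` gives `N ≥ 3`, and `y < x` gives `N ≤ x + 1`. The absolute value keeps the bound nonnegative
for `x < 1`. -/
lemma exists_tail_le : ∃ C : ℝ, 0 ≤ C ∧ ∀ (y : WithTop ℝ) (x : ℝ), ((2 : ℝ) : WithTop ℝ) ≤ y →
    0 ≤ x → tail y x ≤ C * (x * |Real.log x|) * mertensSq y := by
  obtain ⟨C, hC, h⟩ := exists_roughTauSum_le
  refine ⟨C, hC, fun y x hy hx => ?_⟩
  have hnn : 0 ≤ C * (x * |Real.log x|) * mertensSq y :=
    mul_nonneg (by positivity) (mertensSq_nonneg y)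
  by_cases hxy : (x : WithTop ℝ) ≤ y
  · rwa [tail_eq_zero_of_le hx hxy]
  induction y using WithTop.recTopCoe with
  | top => exact absurd le_top hxy
  | coe z =>
    have hz2 : 2 ≤ z := by exact_mod_cast hy
    have hxz : z < x := by exact_mod_cast not_le.1 hxy
    have hz0 : 0 ≤ z := by linarith
    have h1 := h (⌊z⌋₊ + 1) x (by
      have : 2 ≤ ⌊z⌋₊ := Nat.le_floor (by exact_mod_cast hz2)
      omega) (by push_cast; linarith [Nat.floor_le hz0])
    rw [tail_coe_eq hz0 (by linarith), mertensSq_coe hz0,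
      abs_of_nonneg (Real.log_nonneg (by linarith))]
    linarith

/-! ### The main theorem -/

/-- The share of `n` in the divisor sum up to `x`, normalized by `x * log x`. -/
noncomputable def share (θ : ℕ → WithTop ℝ) (x : ℝ) (n : ℕ) : ℝ :=
  tau n * tail (θ n) (x / n) / (x * Real.log x)

lemma tendsto_share {θ : ℕ → WithTop ℝ} {n : ℕ} (hn : 1 ≤ n) (hθn : 0 ≤ θ n) :
    Tendsto (fun x => share θ x n) atTop (𝓝 (term θ n)) := by
  have hn0 : (0 : ℝ) < n := by exact_mod_cast hn
  have := (tendsto_comp_div_mul_log hn0 (tendsto_tail hθn)).const_mul (tau n : ℝ)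
  convert! this using 1
  · ext x; rw [share, mul_div_assoc]
  · rw [term]; congr 1; ring

lemma share_nonneg (θ : ℕ → WithTop ℝ) {x : ℝ} (hx : 1 ≤ x) (n : ℕ) : 0 ≤ share θ x n :=
  div_nonneg (mul_nonneg (Nat.cast_nonneg _) (tail_nonneg _ _))
    (mul_nonneg (by linarith) (Real.log_nonneg hx))

lemma share_eq_zero {θ : ℕ → WithTop ℝ} {x : ℝ} {n : ℕ} (hn : ⌊x⌋₊ < n) : share θ x n = 0 := by
  have h : ⌊x / n⌋₊ = 0 := by
    rw [Nat.floor_div_natCast]; exact Nat.div_eq_of_lt hn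
  simp [share, tail, h]

lemma exists_share_le : ∃ C : ℝ, ∀ (θ : ℕ → WithTop ℝ) (n : ℕ) (x : ℝ),
    ((2 : ℝ) : WithTop ℝ) ≤ θ n → 1 ≤ n → 1 < x → share θ x n ≤ C * term θ n := by
  obtain ⟨C, hC, h⟩ := exists_tail_le
  refine ⟨C, fun θ n x hθ hn hx => ?_⟩
  have hl : 0 < Real.log x := Real.log_pos hx
  have hx0 : 0 < x := by linarith
  have hn0 : (0 : ℝ) < n := by exact_mod_cast hn
  have hm := mertensSq_nonneg (θ n)
  have ht : 0 ≤ term θ n := mul_nonneg (by positivity) hm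
  by_cases hxn : ⌊x⌋₊ < n
  · rw [share_eq_zero hxn]
    exact mul_nonneg hC ht
  have hnx : (n : ℝ) ≤ x := (Nat.le_floor_iff hx0.le).1 (not_lt.1 hxn)
  have hlog : |Real.log (x / n)| ≤ Real.log x := by
    rw [abs_of_nonneg (Real.log_nonneg ((one_le_div hn0).2 hnx))]
    exact Real.log_le_log (by positivity) (div_le_self hx0.le (by exact_mod_cast hn))
  rw [share, div_le_iff₀ (by positivity)]
  calc tau n * tail (θ n) (x / n)
      ≤ tau n * (C * (x / n * |Real.log (x / n)|) * mertensSq (θ n)) := by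
        gcongr; exact h _ _ hθ (by positivity)
    _ ≤ tau n * (C * (x / n * Real.log x) * mertensSq (θ n)) := by gcongr
    _ = _ := by rw [term]; ring

lemma T_nonneg (θ : ℕ → WithTop ℝ) (x : ℝ) : 0 ≤ T θ x :=
  sum_nonneg fun _ _ => Nat.cast_nonneg _

lemma hasSum_share {θ : ℕ → WithTop ℝ} (hθ : DominatesPrimes θ) (x : ℝ) :
    HasSum (fun n : B θ => share θ x n) ((roughTauSum ∅ x - T θ x) / (x * Real.log x)) := by
  classical
  have h1 : (roughTauSum ∅ x - T θ x) / (x * Real.log x) =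
      ∑ n ∈ Ioc 0 ⌊x⌋₊, (B θ).indicator (share θ x) n := by
    rw [roughTauSum_empty_eq hθ, add_sub_cancel_left, sum_div, sum_filter]
    rfl
  rw [h1]
  refine (hasSum_subtype_iff_indicator (f := share θ x)).2
    (hasSum_sum_of_ne_finset_zero fun n hn => ?_)
  by_cases hB : n ∈ B θ
  · rw [Set.indicator_of_mem hB]
    have h0 : 1 ≤ n := hB.1
    refine share_eq_zero ?_
    rw [mem_Ioc] at hn
    omega
  · exact Set.indicator_of_notMem hB _

end ThetaSet

theorem mainTheorem10 (θ : ℕ → WithTop ℝ) (hθ1 : ((2 : ℝ) : WithTop ℝ) ≤ θ 1)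
    (hθ : ∀ n : ℕ, 2 ≤ n → ((ThetaSet.largestPrimeFactor n : ℝ) : WithTop ℝ) ≤ θ n) :
    ∃ L : ℝ, HasSum (fun n : ThetaSet.B θ => ThetaSet.term θ n) L ∧
      0 ≤ L ∧ L ≤ 1 ∧
      (fun x : ℝ => ThetaSet.T θ x - (1 - L) * x * Real.log x)
        =o[Filter.atTop] (fun x : ℝ => x * Real.log x) ∧
      (L = 1 ↔ ThetaSet.T θ =o[Filter.atTop] (fun x : ℝ => x * Real.log x)) := by
  open ThetaSet in
  have hdom := dominatesPrimes_of_largestPrimeFactor_le hθ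
  have h2 : ∀ n, 1 ≤ n → ((2 : ℝ) : WithTop ℝ) ≤ θ n := by
    intro n hn
    rcases hn.eq_or_lt with rfl | hn
    · exact hθ1
    · refine le_trans ?_ (hdom n n.minFac (Nat.mem_primeFactors.2
        ⟨Nat.minFac_prime hn.ne', n.minFac_dvd, by omega⟩))
      exact_mod_cast (Nat.minFac_prime hn.ne').two_le
  have hterm0 : ∀ n, 0 ≤ term θ n := fun n =>
    mul_nonneg (by positivity) (mertensSq_nonneg _)
  have hlim : ∀ n : B θ, Tendsto (fun x => share θ x n) atTop (𝓝 (term θ n)) := fun n =>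
    tendsto_share n.2.1 (le_trans (by exact_mod_cast zero_le_two) (h2 n n.2.1))
  -- At each `x`, finitely many shares sum to at most the normalized full divisor sum, which tends
  -- to `1`.
  have hpart : ∀ s : Finset (B θ), ∑ n ∈ s, term θ n ≤ 1 := by
    intro s
    refine le_of_tendsto_of_tendsto (tendsto_finsetSum s fun n _ => hlim n)
      tendsto_roughTauSum_empty ?_
    filter_upwards [eventually_gt_atTop 1] with x hx
    refine (sum_le_hasSum s (fun n _ => share_nonneg θ hx.le n) (hasSum_share hdom x)).trans ?_
    have : 0 < x * Real.log x := mul_pos (by linarith) (Real.log_pos hx)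
    gcongr
    linarith [T_nonneg θ x]
  have hsum : Summable fun n : B θ => term θ n :=
    summable_of_sum_le (fun n => hterm0 n) hpart
  obtain ⟨C, hC⟩ := exists_share_le
  -- The majorant is `C * term θ n`, whose summability comes from `hpart` alone.
  have hdct : Tendsto (fun x => ∑' n : B θ, share θ x n) atTop (𝓝 (∑' n : B θ, term θ n)) := by
    refine tendsto_tsum_of_dominated_convergence (hsum.mul_left C) hlim ?_
    filter_upwards [eventually_gt_atTop 1] with x hx n
    rw [Real.norm_of_nonneg (share_nonneg θ hx.le n)]
    exact hC θ n x (h2 n n.2.1) n.2.1 hx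
  set L := ∑' n : B θ, term θ n with hL
  have hT : Tendsto (fun x => T θ x / (x * Real.log x)) atTop (𝓝 (1 - L)) := by
    refine (tendsto_roughTauSum_empty.sub hdct).congr fun x => ?_
    rw [(hasSum_share hdom x).tsum_eq]
    ring
  have hne : ∀ᶠ x : ℝ in atTop, x * Real.log x ≠ 0 := by
    filter_upwards [eventually_gt_atTop 1] with x hx
    exact (mul_pos (by linarith) (Real.log_pos hx)).ne'
  refine ⟨L, hsum.hasSum, tsum_nonneg fun n => hterm0 n, hsum.tsum_le_of_sum_le hpart, ?_, ?_⟩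
  · rw [Asymptotics.isLittleO_iff_tendsto' (hne.mono fun x hx h => absurd h hx)]
    have h3 := hT.sub_const (1 - L)
    rw [sub_self] at h3
    refine h3.congr' ?_
    filter_upwards [hne] with x hx
    rw [sub_div, mul_assoc, mul_div_assoc, div_self hx, mul_one]
  · rw [Asymptotics.isLittleO_iff_tendsto' (hne.mono fun x hx h => absurd h hx)]
    constructor
    · intro h
      rwa [h, sub_self] at hT
    · intro h
      linarith [tendsto_nhds_unique hT h]
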